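/- \textbf{Theorem (energy stability and MBP preservation of the PCC scheme).} Let $\Omega\subset\mathbb R^d$ be a bounded open set and let $V$ be a linear space with $C_c^\infty(\Omega)\subseteq V\subseteq H^1(\Omega)$ that encodes the boundary conditions (for example $V=H^1_0(\Omega)$ for homogeneous Dirichlet, $V=H^1(\Omega)$ for homogeneous Neumann, $V=H^1_{\mathrm{per}}(\Omega)$ for periodic conditions on a box). Let $F:\mathbb R\to\mathbb R$ be differentiable with $f=F'\in C^1(\mathbb R)$, and let $\beta>0$ be such that $f(z)\le 0$ for all $z\le-\beta$ and $f(z)\ge 0$ for all $z\ge\beta$. Define $$\mathcal E[u]=\int_\Omega\Big(\tfrac12|\nabla u|^2+F(u)\Big)\,dx\in(-\infty,+\infty]\quad\text{for }u\in H^1(\Omega),\qquad \mathcal E[u]=+\infty\ \text{ otherwise},\qquad p(z)=-(z+\beta)(z-\beta).$$ Let $\tau>0$, let $\Phi_\tau$ be an arbitrary map on real functions (the predictor), and let $\phi^0\in V$ satisfy $\|\phi^0\|_{L^\infty(\Omega)}\le\beta$. Let $(\phi^n)_{n\ge0}$ be a numerical solution of the predictor-corrector-corrector (PCC) scheme, that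 is, for every $n\ge 0$ the following three steps hold. 1. (Predictor) $\psi^{n+1}=\Phi_\tau(\phi^n)\in L^2(\Omega)$. 2. (Corrector 1, energy projection) There are $\phi_*^{n+1}\in V$ and $\eta^{n+1}\in\mathbb R$ such that $$\phi_*^{n+1}-\psi^{n+1}=-\eta^{n+1}\big[-\Delta\phi_*^{n+1}+f(\psi^{n+1})\big]$$ in the weak sense, i.e. $\int_\Omega(\phi_*^{n+1}-\psi^{n+1})v\,dx=-\eta^{n+1}\big(\int_\Omega\nabla\phi_*^{n+1}\cdot\nabla v\,dx+\int_\Omega f(\psi^{n+1})v\,dx\big)$ for all $v\in V$ (where $f(\psi^{n+1})v$ is integrable on $\Omega$ for all $v\in V$ unless $\eta^{n+1}=0$), and $$\eta^{n+1}\ge0,\qquad \mathcal E[\phi_*^{n+1}]-\mathcal E[\phi^n]\le0,\qquad \eta^{n+1}\big(\mathcal E[\phi_*^{n+1}]-\mathcal E[\phi^n]\big)=0.$$ 3. (Corrector 2, maximum bound projection) There is $\lambda^{n+1}:\Omega\to\mathbb R$ such that, almost everywhere in $\Omega$, $$\phi^{n+1}-\phi_*^{n+1}=\lambda^{n+1}p'(\phi^{n+1}),\qquad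 \lambda^{n+1}\ge0,\qquad p(\phi^{n+1})\ge0,\qquad \lambda^{n+1}p(\phi^{n+1})=0.$$ Then, for all $n\ge0$, $$\|\phi^n\|_{L^\infty(\Omega)}\le\beta\qquad\text{and}\qquad \mathcal E[\phi^{n+1}]\le\mathcal E[\phi^n].$$ -/

import Mathlib

open MeasureTheory Filter Topology Gradient
open scoped ENNReal ContDiff

noncomputable section

/-- `ℝᵈ` with its Euclidean norm. -/
abbrev Euc (d : ℕ) : Type := EuclideanSpace ℝ (Fin d)

/-! ### Sobolev spaces of order one -/

/-- `ψ ∈ C_c^∞(Ω)`. -/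
def IsTestFunction {d : ℕ} (Ω : Set (Euc d)) (ψ : Euc d → ℝ) : Prop :=
  ContDiff ℝ ∞ ψ ∧ HasCompactSupport ψ ∧ tsupport ψ ⊆ Ω

/-- Integration by parts over `Ω` of `u`, with gradient `G`, against the function `ψ`. -/
def IntegratesByParts {d : ℕ} (Ω : Set (Euc d)) (u : Euc d → ℝ) (G : Euc d → Euc d)
    (ψ : Euc d → ℝ) : Prop :=
  ∫ x in Ω, u x • gradient ψ x = - ∫ x in Ω, ψ x • G x

/-- `u ∈ L²(Ω)`, and `G ∈ L²(Ω; ℝᵈ)` is the weak (distributional) gradient of `u` in `Ω`. -/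
structure HasWeakGradient {d : ℕ} (Ω : Set (Euc d)) (u : Euc d → ℝ) (G : Euc d → Euc d) :
    Prop where
  memLp : MemLp u 2 (volume.restrict Ω)
  memLp_grad : MemLp G 2 (volume.restrict Ω)
  parts : ∀ ψ, IsTestFunction Ω ψ → IntegratesByParts Ω u G ψ

lemma IsTestFunction.continuous_gradient {d : ℕ} {ψ : Euc d → ℝ} (h : ContDiff ℝ ∞ ψ) :
    Continuous (gradient ψ) := by
  have h1 : Continuous (fderiv ℝ ψ) := h.continuous_fderiv (by simp)
  exact (InnerProductSpace.toDual ℝ (Euc d)).symm.continuous.comp h1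

lemma IsTestFunction.gradient_compact {d : ℕ} {Ω : Set (Euc d)} {ψ : Euc d → ℝ}
    (h : IsTestFunction Ω ψ) : HasCompactSupport (gradient ψ) := by
  have h1 : HasCompactSupport (fderiv ℝ ψ) := h.2.1.fderiv ℝ
  exact h1.comp_left (g := (InnerProductSpace.toDual ℝ (Euc d)).symm) (by simp)

lemma IsTestFunction.memLp {d : ℕ} {Ω : Set (Euc d)} {ψ : Euc d → ℝ}
    (h : IsTestFunction Ω ψ) : MemLp ψ 2 (volume.restrict Ω) :=
  (h.1.continuous.memLp_of_hasCompactSupport h.2.1).mono_measure Measure.restrict_le_self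

lemma IsTestFunction.memLp_gradient {d : ℕ} {Ω : Set (Euc d)} {ψ : Euc d → ℝ}
    (h : IsTestFunction Ω ψ) : MemLp (gradient ψ) 2 (volume.restrict Ω) :=
  ((IsTestFunction.continuous_gradient h.1).memLp_of_hasCompactSupport
    h.gradient_compact).mono_measure Measure.restrict_le_self

lemma integrable_smul_of_memLp_two {d : ℕ} {μ : Measure (Euc d)} {u : Euc d → ℝ}
    {G : Euc d → Euc d} (hu : MemLp u 2 μ) (hG : MemLp G 2 μ) :
    Integrable (fun x => u x • G x) μ := by
  have := MemLp.smul (r := 1) hG hu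
  exact memLp_one_iff_integrable.1 this

lemma IntegratesByParts.zero {d : ℕ} (Ω : Set (Euc d)) (ψ : Euc d → ℝ) :
    IntegratesByParts Ω 0 0 ψ := by
  simp [IntegratesByParts]

lemma IntegratesByParts.add {d : ℕ} {Ω : Set (Euc d)} {u v : Euc d → ℝ} {G H : Euc d → Euc d}
    {ψ : Euc d → ℝ} (hψ : MemLp ψ 2 (volume.restrict Ω))
    (hψ' : MemLp (gradient ψ) 2 (volume.restrict Ω))
    (hu : MemLp u 2 (volume.restrict Ω)) (hv : MemLp v 2 (volume.restrict Ω))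
    (hG : MemLp G 2 (volume.restrict Ω)) (hH : MemLp H 2 (volume.restrict Ω))
    (h1 : IntegratesByParts Ω u G ψ) (h2 : IntegratesByParts Ω v H ψ) :
    IntegratesByParts Ω (u + v) (G + H) ψ := by
  unfold IntegratesByParts at *
  simp only [Pi.add_apply, add_smul, smul_add]
  rw [integral_add (integrable_smul_of_memLp_two hu hψ') (integrable_smul_of_memLp_two hv hψ'),
    integral_add (integrable_smul_of_memLp_two hψ hG) (integrable_smul_of_memLp_two hψ hH), h1, h2,
    neg_add]

lemma IntegratesByParts.smul {d : ℕ} {Ω : Set (Euc d)} {u : Euc d → ℝ} {G : Euc d → Euc d}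
    {ψ : Euc d → ℝ} (c : ℝ) (h : IntegratesByParts Ω u G ψ) :
    IntegratesByParts Ω (c • u) (c • G) ψ := by
  unfold IntegratesByParts at *
  simp only [Pi.smul_apply, smul_assoc, smul_comm _ c, integral_smul]
  rw [h, smul_neg]

lemma HasWeakGradient.zero {d : ℕ} (Ω : Set (Euc d)) : HasWeakGradient Ω 0 0 :=
  ⟨MemLp.zero, MemLp.zero, fun ψ _ => IntegratesByParts.zero Ω ψ⟩

lemma HasWeakGradient.add {d : ℕ} {Ω : Set (Euc d)} {u v : Euc d → ℝ} {G H : Euc d → Euc d}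
    (hu : HasWeakGradient Ω u G) (hv : HasWeakGradient Ω v H) :
    HasWeakGradient Ω (u + v) (G + H) :=
  ⟨hu.1.add hv.1, hu.2.add hv.2, fun ψ hψ => IntegratesByParts.add hψ.memLp hψ.memLp_gradient
    hu.1 hv.1 hu.2 hv.2 (hu.3 ψ hψ) (hv.3 ψ hψ)⟩

lemma HasWeakGradient.smul {d : ℕ} {Ω : Set (Euc d)} {u : Euc d → ℝ} {G : Euc d → Euc d}
    (c : ℝ) (hu : HasWeakGradient Ω u G) : HasWeakGradient Ω (c • u) (c • G) :=
  ⟨hu.1.const_smul c, hu.2.const_smul c, fun ψ hψ => (hu.3 ψ hψ).smul c⟩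

/-- The Sobolev space `H¹(Ω)` (of representatives; only the values in `Ω` matter). -/
def H1 {d : ℕ} (Ω : Set (Euc d)) : Submodule ℝ (Euc d → ℝ) where
  carrier := {u | ∃ G, HasWeakGradient Ω u G}
  zero_mem' := ⟨0, HasWeakGradient.zero Ω⟩
  add_mem' := fun ⟨_, hu⟩ ⟨_, hv⟩ => ⟨_, hu.add hv⟩
  smul_mem' := fun c _ ⟨_, hu⟩ => ⟨_, hu.smul c⟩

open Classical in
/-- The weak gradient of `u ∈ H¹(Ω)` (unique up to a null set when `Ω` is open). -/
def weakGradient {d : ℕ} (Ω : Set (Euc d)) (u : Euc d → ℝ) : Euc d → Euc d :=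
  if h : ∃ G, HasWeakGradient Ω u G then h.choose else 0

/-! ### Boundary conditions, through the space in which the problem is posed -/

/-- A space of `H¹` functions that encodes boundary conditions without a contribution in
integration by parts: a linear space between `C_c^∞(Ω)` and `H¹(Ω)`, whose elements serve both as
trial and as test functions. The homogeneous Dirichlet space `H1Zero`, the homogeneous
Neumann space `H1` (natural boundary condition) and the periodic space `H1Periodic` are the basic
examples, see `isBoundarySpace_H1Zero`, `isBoundarySpace_H1`, `isBoundarySpace_H1Periodic`. -/
structure IsBoundarySpace {d : ℕ} (Ω : Set (Euc d)) (V : Submodule ℝ (Euc d → ℝ)) : Prop where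
  le_H1 : V ≤ H1 Ω
  test_mem : ∀ ψ, IsTestFunction Ω ψ → ψ ∈ V

/-- `H¹₀(Ω)`: the closure of `C_c^∞(Ω)` in `H¹(Ω)` (homogeneous Dirichlet condition). -/
def H1Zero {d : ℕ} (Ω : Set (Euc d)) : Submodule ℝ (Euc d → ℝ) where
  carrier := {u | ∃ G, HasWeakGradient Ω u G ∧ ∃ ψ : ℕ → Euc d → ℝ,
    (∀ k, IsTestFunction Ω (ψ k)) ∧
    Tendsto (fun k => eLpNorm (ψ k - u) 2 (volume.restrict Ω)) atTop (𝓝 0) ∧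
    Tendsto (fun k => eLpNorm (gradient (ψ k) - G) 2 (volume.restrict Ω)) atTop (𝓝 0)}
  zero_mem' := by
    have h0 : IsTestFunction Ω (0 : Euc d → ℝ) :=
      ⟨contDiff_const, HasCompactSupport.zero, by simp [tsupport]⟩
    have hg : gradient (0 : Euc d → ℝ) = 0 := by
      funext x; exact gradient_const x 0
    refine ⟨0, HasWeakGradient.zero Ω, fun _ => 0, fun _ => h0, ?_, ?_⟩
    · simp
    · simp [hg]
  add_mem' := by
    rintro u v ⟨G, hG, ψ, hψ, h1, h2⟩ ⟨H, hH, χ, hχ, h3, h4⟩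
    have hgr : ∀ k, gradient (ψ k + χ k) = gradient (ψ k) + gradient (χ k) := by
      intro k; funext x
      simp only [gradient, Pi.add_apply]
      rw [fderiv_add ((hψ k).1.differentiable (by simp) x) ((hχ k).1.differentiable (by simp) x),
        map_add]
    refine ⟨_, hG.add hH, fun k => ψ k + χ k, fun k => ⟨(hψ k).1.add (hχ k).1,
      (hψ k).2.1.add (hχ k).2.1, (tsupport_add _ _).trans
        (Set.union_subset (hψ k).2.2 (hχ k).2.2)⟩, ?_, ?_⟩
    · refine tendsto_of_tendsto_of_tendsto_of_le_of_le tendsto_const_nhds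
        (by simpa using h1.add h3) (fun _ => zero_le) (fun k => ?_)
      have e : ψ k + χ k - (u + v) = (ψ k - u) + (χ k - v) := by abel
      simp only [e]
      exact eLpNorm_add_le ((hψ k).memLp.1.sub hG.1.1) ((hχ k).memLp.1.sub hH.1.1) (by norm_num)
    · refine tendsto_of_tendsto_of_tendsto_of_le_of_le tendsto_const_nhds
        (by simpa using h2.add h4) (fun _ => zero_le) (fun k => ?_)
      have e : gradient (ψ k + χ k) - (G + H) = (gradient (ψ k) - G) + (gradient (χ k) - H) := by
        rw [hgr k]; abel
      simp only [e]
      exact eLpNorm_add_le ((hψ k).memLp_gradient.1.sub hG.2.1)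
        ((hχ k).memLp_gradient.1.sub hH.2.1) (by norm_num)
  smul_mem' := by
    rintro c u ⟨G, hG, ψ, hψ, h1, h2⟩
    have hgr : ∀ k, gradient (c • ψ k) = c • gradient (ψ k) := by
      intro k; funext x
      simp only [gradient, Pi.smul_apply]
      rw [fderiv_const_smul ((hψ k).1.differentiable (by simp) x)]
      simp
    refine ⟨_, hG.smul c, fun k => c • ψ k, fun k => ⟨contDiff_const.smul (hψ k).1,
      (hψ k).2.1.smul_left, (tsupport_smul_subset_right (fun _ => c) _).trans (hψ k).2.2⟩, ?_, ?_⟩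
    · have := ENNReal.Tendsto.const_mul (a := ‖c‖ₑ) h1 (Or.inr (by simp))
      simpa [← smul_sub, eLpNorm_const_smul] using this
    · have := ENNReal.Tendsto.const_mul (a := ‖c‖ₑ) h2 (Or.inr (by simp))
      simpa [hgr, ← smul_sub, eLpNorm_const_smul] using this

/-- The open box with corner `a` and side lengths `L`. -/
def openBox {d : ℕ} (a L : Fin d → ℝ) : Set (Euc d) :=
  {x | ∀ i, a i < x i ∧ x i < a i + L i}

/-- Smooth functions on `ℝᵈ` with period `L i` in the `i`-th coordinate. -/
def IsPeriodicTestFunction {d : ℕ} (L : Fin d → ℝ) (ψ : Euc d → ℝ) : Prop :=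
  ContDiff ℝ ∞ ψ ∧ ∀ i x, ψ (x + EuclideanSpace.single i (L i)) = ψ x

lemma memLp_openBox {d : ℕ} (a L : Fin d → ℝ) {F : Type*} [NormedAddCommGroup F]
    {g : Euc d → F} (hg : Continuous g) : MemLp g 2 (volume.restrict (openBox a L)) := by
  have hK : IsCompact ((WithLp.toLp 2) '' (Set.Icc a (a + L)) : Set (Euc d)) :=
    isCompact_Icc.image (PiLp.continuous_toLp 2 _)
  have hsub : openBox a L ⊆ ((WithLp.toLp 2) '' (Set.Icc a (a + L)) : Set (Euc d)) := by
    intro x hx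
    exact ⟨WithLp.ofLp x, ⟨fun i => (hx i).1.le, fun i => (hx i).2.le⟩, rfl⟩
  have : MemLp g 2 (volume.restrict ((WithLp.toLp 2) '' (Set.Icc a (a + L)) : Set (Euc d))) := by
    have : IsFiniteMeasure
        (volume.restrict ((WithLp.toLp 2) '' (Set.Icc a (a + L)) : Set (Euc d))) :=
      ⟨by simpa using hK.measure_lt_top⟩
    obtain ⟨C, hC⟩ := hK.exists_bound_of_continuousOn hg.continuousOn
    refine MemLp.of_bound (hg.continuousOn.aestronglyMeasurable_of_isCompact hK hK.measurableSet) C ?_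
    exact (ae_restrict_iff' hK.measurableSet).2 (Eventually.of_forall hC)
  exact this.mono_measure (Measure.restrict_mono hsub le_rfl)

/-- `H¹_per`: the functions in `H¹` of the box whose weak gradient satisfies the integration
by parts formula, without boundary terms, against all smooth periodic functions; equivalently,
those whose periodic extension is locally in `H¹` (periodic boundary condition). -/
def H1Periodic {d : ℕ} (a L : Fin d → ℝ) : Submodule ℝ (Euc d → ℝ) where
  carrier := {u | ∃ G, HasWeakGradient (openBox a L) u G ∧
    ∀ ψ, IsPeriodicTestFunction L ψ → IntegratesByParts (openBox a L) u G ψ}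
  zero_mem' := ⟨0, HasWeakGradient.zero _, fun ψ _ => IntegratesByParts.zero _ ψ⟩
  add_mem' := fun ⟨_, hu, hu'⟩ ⟨_, hv, hv'⟩ => ⟨_, hu.add hv, fun ψ hψ =>
    IntegratesByParts.add (memLp_openBox a L hψ.1.continuous)
      (memLp_openBox a L (IsTestFunction.continuous_gradient hψ.1)) hu.1 hv.1 hu.2 hv.2
      (hu' ψ hψ) (hv' ψ hψ)⟩
  smul_mem' := fun c _ ⟨_, hu, hu'⟩ => ⟨_, hu.smul c, fun ψ hψ => (hu' ψ hψ).smul c⟩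

lemma IsTestFunction.integratesByParts {d : ℕ} {Ω : Set (Euc d)} {ψ χ : Euc d → ℝ}
    (hψ : IsTestFunction Ω ψ) (hχ : ContDiff ℝ ∞ χ) :
    IntegratesByParts Ω ψ (gradient ψ) χ := by
  have cψ := hψ.1.continuous
  have cχ := hχ.continuous
  have cψ' := IsTestFunction.continuous_gradient hψ.1
  have cχ' := IsTestFunction.continuous_gradient hχ
  have z1 : ∀ x, x ∉ Ω → ψ x = 0 := fun x hx => image_eq_zero_of_notMem_tsupport
    (fun h => hx (hψ.2.2 h))
  have z2 : ∀ x, x ∉ Ω → gradient ψ x = 0 := by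
    intro x hx
    have : fderiv ℝ ψ x = 0 := by
      by_contra h
      exact hx (hψ.2.2 (support_fderiv_subset ℝ h))
    simp [gradient, this]
  unfold IntegratesByParts
  rw [setIntegral_eq_integral_of_forall_compl_eq_zero (fun x hx => by simp [z1 x hx]),
    setIntegral_eq_integral_of_forall_compl_eq_zero (fun x hx => by simp [z2 x hx])]
  have i1 : Integrable (fun x => ψ x • gradient χ x) (volume : Measure (Euc d)) :=
    (cψ.smul cχ').integrable_of_hasCompactSupport (hψ.2.1.smul_right)
  have i2 : Integrable (fun x => χ x • gradient ψ x) (volume : Measure (Euc d)) :=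
    (cχ.smul cψ').integrable_of_hasCompactSupport (hψ.gradient_compact.smul_left)
  refine ext_inner_left ℝ fun e => ?_
  rw [inner_neg_right, ← integral_inner i1, ← integral_inner i2]
  have cd : ∀ f : Euc d → ℝ, ContDiff ℝ ∞ f → Continuous (fun x => fderiv ℝ f x e) :=
    fun f hf => (hf.continuous_fderiv (by simp)).clm_apply continuous_const
  have sd : HasCompactSupport (fun x => fderiv ℝ ψ x e) := hψ.2.1.fderiv_apply ℝ e
  have j1 : Integrable (fun x => fderiv ℝ ψ x e * χ x) (volume : Measure (Euc d)) :=
    ((cd ψ hψ.1).mul cχ).integrable_of_hasCompactSupport sd.mul_right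
  have j2 : Integrable (fun x => ψ x * fderiv ℝ χ x e) (volume : Measure (Euc d)) :=
    (cψ.mul (cd χ hχ)).integrable_of_hasCompactSupport hψ.2.1.mul_right
  have j3 : Integrable (fun x => ψ x * χ x) (volume : Measure (Euc d)) :=
    (cψ.mul cχ).integrable_of_hasCompactSupport hψ.2.1.mul_right
  have key := integral_mul_fderiv_eq_neg_fderiv_mul_of_integrable j1 j2 j3
    (fun x _ => hψ.1.differentiable (by simp) x) (fun x _ => hχ.differentiable (by simp) x)
  have e1 : ∀ (f : Euc d → ℝ) x, inner ℝ e (gradient f x) = fderiv ℝ f x e := by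
    intro f x
    rw [real_inner_comm, gradient, InnerProductSpace.toDual_symm_apply]
  simp only [inner_smul_right, e1]
  rw [key]
  simp only [mul_comm]

lemma IsTestFunction.hasWeakGradient {d : ℕ} {Ω : Set (Euc d)} {ψ : Euc d → ℝ}
    (hψ : IsTestFunction Ω ψ) : HasWeakGradient Ω ψ (gradient ψ) :=
  ⟨hψ.memLp, hψ.memLp_gradient, fun _ hχ => hψ.integratesByParts hχ.1⟩

theorem isBoundarySpace_H1 {d : ℕ} (Ω : Set (Euc d)) : IsBoundarySpace Ω (H1 Ω) :=
  ⟨le_rfl, fun _ hψ => ⟨_, hψ.hasWeakGradient⟩⟩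

theorem isBoundarySpace_H1Zero {d : ℕ} (Ω : Set (Euc d)) : IsBoundarySpace Ω (H1Zero Ω) :=
  ⟨fun _ ⟨G, hG, _⟩ => ⟨G, hG⟩, fun ψ hψ => ⟨_, hψ.hasWeakGradient, fun _ => ψ, fun _ => hψ,
    by simp, by simp⟩⟩

theorem isBoundarySpace_H1Periodic {d : ℕ} (a L : Fin d → ℝ) :
    IsBoundarySpace (openBox a L) (H1Periodic a L) :=
  ⟨fun _ ⟨G, hG, _⟩ => ⟨G, hG⟩, fun _ hψ => ⟨_, hψ.hasWeakGradient,
    fun _ hχ => hψ.integratesByParts hχ.1⟩⟩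

/-! ### The energy -/

/-- The Lebesgue integral with values in `[-∞, ∞]`: integral of the positive part minus
integral of the negative part. -/
def extendedIntegral {d : ℕ} (μ : Measure (Euc d)) (g : Euc d → ℝ) : EReal :=
  ((∫⁻ x, ENNReal.ofReal (g x) ∂μ : ℝ≥0∞) : EReal) -
    ((∫⁻ x, ENNReal.ofReal (-g x) ∂μ : ℝ≥0∞) : EReal)

open Classical in
/-- The free energy `∫_Ω (½|∇u|² + F(u))`; it is `+∞` outside `H¹(Ω)`. If `F` is
bounded below and `Ω` is bounded, it takes values in `(-∞, ∞]`: `+∞` where `F(u)` is not integrable. -/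
def freeEnergy {d : ℕ} (Ω : Set (Euc d)) (F : ℝ → ℝ) (u : Euc d → ℝ) : EReal :=
  if u ∈ H1 Ω then
    extendedIntegral (volume.restrict Ω)
      (fun x => 1 / 2 * ‖weakGradient Ω u x‖ ^ 2 + F (u x))
  else ⊤

/-! ### The predictor-corrector-corrector scheme -/

/-- The first corrector (energy projection). From `φ = φⁿ` and the prediction `ψ = φ^{n,s+1}` it
determines `φs = φ_*^{n+1} ∈ V` and `η = η^{n+1}` by
`φs - ψ = -η [-Δ φs + f(ψ)]`, with the boundary conditions of `V` (weak formulation), together with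
`η ≥ 0`, `𝓔[φs] - 𝓔[φ] ≤ 0`, `η (𝓔[φs] - 𝓔[φ]) = 0`. -/
structure IsEnergyCorrection {d : ℕ} (Ω : Set (Euc d)) (V : Submodule ℝ (Euc d → ℝ))
    (F f : ℝ → ℝ) (φ ψ φs : Euc d → ℝ) (η : ℝ) : Prop where
  mem : φs ∈ V
  /-- For `η = 0` the equation below does not involve `f(ψ)`. -/
  integrable : η ≠ 0 → ∀ v ∈ V, IntegrableOn (fun x => f (ψ x) * v x) Ω
  equation : ∀ v ∈ V, ∫ x in Ω, (φs x - ψ x) * v x =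
    -η * ((∫ x in Ω, inner ℝ (weakGradient Ω φs x) (weakGradient Ω v x)) +
      ∫ x in Ω, f (ψ x) * v x)
  multiplier_nonneg : 0 ≤ η
  energy_le : freeEnergy Ω F φs ≤ freeEnergy Ω F φ
  complementarity : (η : EReal) * (freeEnergy Ω F φs - freeEnergy Ω F φ) = 0

/-- The quadratic constraint function `p(z) = -(z + β)(z - β)`. -/
def boundConstraint (β z : ℝ) : ℝ := -(z + β) * (z - β)

/-- The second corrector (maximum bound projection). From `φs = φ_*^{n+1}` it determines
`φ' = φ^{n+1}` and the multiplier `l = λ^{n+1}`, a function on `Ω`, by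
`φ' - φs = λ p'(φ')`, `λ ≥ 0`, `p(φ') ≥ 0`, `λ p(φ') = 0`, almost everywhere in `Ω`. -/
def IsBoundCorrection {d : ℕ} (Ω : Set (Euc d)) (β : ℝ) (φs φ' l : Euc d → ℝ) : Prop :=
  ∀ᵐ x ∂(volume.restrict Ω),
    φ' x - φs x = l x * deriv (boundConstraint β) (φ' x) ∧
    0 ≤ l x ∧ 0 ≤ boundConstraint β (φ' x) ∧ l x * boundConstraint β (φ' x) = 0

/-- `φ⁰, φ¹, …` is a numerical solution of the PCC scheme with predictor `Φ`: the
prediction `Φ(φⁿ) ∈ L²(Ω)` is corrected by the two correctors in turn. -/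
def IsPCCSolution {d : ℕ} (Ω : Set (Euc d)) (V : Submodule ℝ (Euc d → ℝ))
    (F f : ℝ → ℝ) (β : ℝ) (Φ : (Euc d → ℝ) → (Euc d → ℝ)) (φ : ℕ → Euc d → ℝ) : Prop :=
  ∀ n, MemLp (Φ (φ n)) 2 (volume.restrict Ω) ∧
    ∃ (φs : Euc d → ℝ) (η : ℝ) (l : Euc d → ℝ),
      IsEnergyCorrection Ω V F f (φ n) (Φ (φ n)) φs η ∧
      IsBoundCorrection Ω β φs (φ (n + 1)) l

end

/-! Both claims reduce to one pointwise fact: the complementarity conditions of the second corrector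
force `φ (n + 1)` to be, almost everywhere, the truncation of `φs` to `[-β, β]`
(`IsBoundCorrection.ae_eq_truncation`). The maximum bound is then the constraint `p ≥ 0`. The first
corrector imposes 𝓔[φs] ≤ 𝓔[φⁿ], so it remains to see that truncation does not raise the energy
(`freeEnergy_le_of_ae_eq_truncation`).

The potential part decreases because F is nonincreasing on (-∞, -β] and nondecreasing on [β, ∞)
(`potential_truncation_le`). The gradient part decreases because the weak gradient of the truncation
of u is the weak gradient of u times a factor of modulus at most one (`HasWeakGradient.truncation`).

That chain rule carries the analytic work. Extend u and its gradient by zero and mollify. On a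
compact subset of Ω the mollified function eventually has the mollified weak derivative as its
classical derivative, and L¹ convergence of mollifications gives the chain rule for bounded C¹
functions (`HasWeakDirDeriv.comp`). Replacing |z| by √(z² + ε²) approximates the truncation by such
functions. Their derivatives converge at every point, the kinks included, so dominated convergence
finishes without an analysis of the level sets {u = ±β}. -/

noncomputable section

open scoped Convolution

/-! ### Convergence of mollifications in `L¹` -/

/-- The Scheffé lemma for nonnegative functions of constant integral. -/
lemma tendsto_integral_abs_sub_of_nonneg {α : Type*} [MeasurableSpace α] {μ : Measure α}
    {h : ℕ → α → ℝ} {g : α → ℝ} (hh : ∀ k, Integrable (h k) μ) (hg : Integrable g μ)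
    (hh0 : ∀ k x, 0 ≤ h k x) (hg0 : ∀ x, 0 ≤ g x) (hint : ∀ k, ∫ x, h k x ∂μ = ∫ x, g x ∂μ)
    (hlim : ∀ᵐ x ∂μ, Tendsto (fun k => h k x) atTop (𝓝 (g x))) :
    Tendsto (fun k => ∫ x, |h k x - g x| ∂μ) atTop (𝓝 0) := by
  -- The pointwise identity |h - g| = 2 (g - h)⁺ - (g - h) loses its last term on integration, since
  -- the integrals agree. What remains is dominated by g, because h ≥ 0.
  have e : ∀ k, ∫ x, |h k x - g x| ∂μ = 2 * ∫ x, max (g x - h k x) 0 ∂μ := by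
    intro k
    have i1 : Integrable (fun x => max (g x - h k x) 0) μ := (hg.sub (hh k)).pos_part
    have i2 : Integrable (fun x => g x - h k x) μ := hg.sub (hh k)
    have e2 : ∀ x, |h k x - g x| = 2 * max (g x - h k x) 0 - (g x - h k x) := by
      intro x
      rcases le_total (g x) (h k x) with h1 | h1
      · rw [abs_of_nonneg (by linarith), max_eq_right (by linarith)]; ring
      · rw [abs_of_nonpos (by linarith), max_eq_left (by linarith)]; ring
    simp_rw [e2]
    rw [integral_sub (i1.const_mul 2) i2, integral_const_mul, integral_sub hg (hh k), hint k]
    ring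
  simp_rw [e]
  have : Tendsto (fun k => ∫ x, max (g x - h k x) 0 ∂μ) atTop (𝓝 (∫ _, (0 : ℝ) ∂μ)) := by
    refine tendsto_integral_of_dominated_convergence g
      (fun k => (hg.sub (hh k)).pos_part.aestronglyMeasurable) hg (fun k => ?_) ?_
    · refine Eventually.of_forall fun x => ?_
      rw [Real.norm_of_nonneg (le_max_right _ _)]
      exact max_le (by linarith [hh0 k x]) (hg0 x)
    · filter_upwards [hlim] with x hx
      have := (tendsto_const_nhds (x := g x)).sub hx
      simpa using this.max (tendsto_const_nhds (x := (0 : ℝ)))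
  simpa using this.const_mul 2

/-- Bump functions around `0` with radii tending to zero. -/
def shrinkingBump (d : ℕ) (k : ℕ) : ContDiffBump (0 : Euc d) :=
  ⟨1 / (k + 1), 2 / (k + 1), by positivity, by gcongr; norm_num⟩

lemma shrinkingBump_rOut (d k : ℕ) : (shrinkingBump d k).rOut = 2 / (k + 1) := rfl

lemma shrinkingBump_rIn (d k : ℕ) : (shrinkingBump d k).rIn = 1 / (k + 1) := rfl

lemma tendsto_shrinkingBump_rOut (d : ℕ) :
    Tendsto (fun k => (shrinkingBump d k).rOut) atTop (𝓝 0) := by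
  have := (tendsto_one_div_add_atTop_nhds_zero_nat (𝕜 := ℝ)).const_mul 2
  simp only [shrinkingBump_rOut]
  refine (this.congr fun k => ?_).trans (by simp)
  ring

/-- The normalized bump functions. -/
def mollifier (d : ℕ) (k : ℕ) : Euc d → ℝ := (shrinkingBump d k).normed volume

lemma mollifier_contDiff (d k : ℕ) : ContDiff ℝ ∞ (mollifier d k) :=
  (shrinkingBump d k).contDiff_normed

lemma mollifier_hasCompactSupport (d k : ℕ) : HasCompactSupport (mollifier d k) :=
  (shrinkingBump d k).hasCompactSupport_normed

lemma mollifier_integrable (d k : ℕ) : Integrable (mollifier d k) volume :=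
  (mollifier_contDiff d k).continuous.integrable_of_hasCompactSupport
    (mollifier_hasCompactSupport d k)

lemma mollifier_nonneg (d k : ℕ) (x : Euc d) : 0 ≤ mollifier d k x :=
  (shrinkingBump d k).nonneg_normed x

/-- The mollification of a function. -/
def mollify {d : ℕ} (k : ℕ) (u : Euc d → ℝ) : Euc d → ℝ :=
  mollifier d k ⋆[ContinuousLinearMap.lsmul ℝ ℝ, volume] u

lemma mollify_apply {d : ℕ} (k : ℕ) (u : Euc d → ℝ) (x : Euc d) :
    mollify k u x = ∫ t, u t * mollifier d k (x - t) := by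
  rw [mollify, convolution_eq_swap]
  simp [mul_comm]

lemma mollify_integrable {d : ℕ} (k : ℕ) {u : Euc d → ℝ} (hu : Integrable u volume) :
    Integrable (mollify k u) volume :=
  (mollifier_integrable d k).integrable_convolution _ hu

lemma integral_mollify {d : ℕ} (k : ℕ) {u : Euc d → ℝ} (hu : Integrable u volume) :
    ∫ x, mollify k u x = ∫ x, u x := by
  rw [mollify, integral_convolution _ (mollifier_integrable d k) hu, mollifier,
    ContDiffBump.integral_normed]
  simp

lemma tendsto_mollify_ae {d : ℕ} {u : Euc d → ℝ} (hu : Integrable u volume) :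
    ∀ᵐ x, Tendsto (fun k => mollify k u x) atTop (𝓝 (u x)) := by
  -- Almost everywhere convergence needs a bound K on the ratio of outer to inner radius; here the
  -- ratio is exactly 2.
  refine ContDiffBump.ae_convolution_tendsto_right_of_locallyIntegrable (K := 2)
    (tendsto_shrinkingBump_rOut d) (Eventually.of_forall fun k => ?_) hu.locallyIntegrable
  rw [shrinkingBump_rOut, shrinkingBump_rIn]
  exact le_of_eq (by ring)

lemma mollify_sub {d : ℕ} (k : ℕ) {u v : Euc d → ℝ} (hu : Integrable u volume)
    (hv : Integrable v volume) (x : Euc d) :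
    mollify k (fun y => u y - v y) x = mollify k u x - mollify k v x := by
  have hi : ∀ {w : Euc d → ℝ}, Integrable w volume →
      Integrable (fun t => w t * mollifier d k (x - t)) volume := by
    intro w hw
    obtain ⟨C, hC⟩ := (mollifier_hasCompactSupport d k).exists_bound_of_continuous
      (mollifier_contDiff d k).continuous
    exact hw.mul_bdd (c := C) ((mollifier_contDiff d k).continuous.comp
      (continuous_const.sub continuous_id)).aestronglyMeasurable
      (Eventually.of_forall fun t => hC _)
  simp only [mollify_apply, sub_mul]
  exact integral_sub (hi hu) (hi hv)

/-- Convolution with a nonnegative kernel of mass one preserves both sign and integral, so almost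
everywhere convergence upgrades to L¹ convergence by the Scheffé lemma. -/
lemma tendsto_integral_abs_mollify_sub_of_nonneg {d : ℕ} {u : Euc d → ℝ}
    (hu : Integrable u volume) (h0 : ∀ x, 0 ≤ u x) :
    Tendsto (fun k => ∫ x, |mollify k u x - u x|) atTop (𝓝 0) := by
  refine tendsto_integral_abs_sub_of_nonneg (fun k => mollify_integrable k hu) hu (fun k x => ?_)
    h0 (fun k => integral_mollify k hu) (tendsto_mollify_ae hu)
  rw [mollify_apply]
  exact integral_nonneg fun t => mul_nonneg (h0 t) (mollifier_nonneg d k _)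

/-- Mollifications of an integrable function converge to it in `L¹`. -/
lemma tendsto_integral_abs_mollify_sub {d : ℕ} {u : Euc d → ℝ} (hu : Integrable u volume) :
    Tendsto (fun k => ∫ x, |mollify k u x - u x|) atTop (𝓝 0) := by
  -- The Scheffé argument needs a sign, so positive and negative parts are mollified separately.
  have hp : Integrable (fun x => max (u x) 0) volume := hu.pos_part
  have hn : Integrable (fun x => max (-u x) 0) volume := hu.neg_part
  have hsum := (tendsto_integral_abs_mollify_sub_of_nonneg hp fun x => le_max_right _ _).add
    (tendsto_integral_abs_mollify_sub_of_nonneg hn fun x => le_max_right _ _)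
  rw [add_zero] at hsum
  have hu' : u = fun x => max (u x) 0 - max (-u x) 0 := by
    funext x
    exact (max_zero_sub_max_neg_zero_eq_self (u x)).symm
  refine squeeze_zero (fun k => integral_nonneg fun x => abs_nonneg _) (fun k => ?_) hsum
  have ip := ((mollify_integrable k hp).sub hp).abs
  have iN := ((mollify_integrable k hn).sub hn).abs
  refine (integral_mono ((mollify_integrable k hu).sub hu).abs (ip.add iN) fun x => ?_).trans_eq
    (integral_add ip iN)
  have e1 : mollify k u x = mollify k (fun y => max (u y) 0) x -
      mollify k (fun y => max (-u y) 0) x := by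
    rw [← mollify_sub k hp hn x, ← hu']
  have e2 : u x = max (u x) 0 - max (-u x) 0 := (max_zero_sub_max_neg_zero_eq_self (u x)).symm
  simp only [Pi.sub_apply, Pi.add_apply]
  rw [e1]
  calc _ = |(mollify k (fun y => max (u y) 0) x - max (u x) 0) -
        (mollify k (fun y => max (-u y) 0) x - max (-u x) 0)| := by
        congr 1; linarith
    _ ≤ _ := abs_sub _ _

/-! ### The weak directional derivative -/

/-- `g` is the weak derivative of `u` in the direction `e`, inside `Ω`. -/
def HasWeakDirDeriv {d : ℕ} (Ω : Set (Euc d)) (e : Euc d) (u g : Euc d → ℝ) : Prop :=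
  ∀ ψ, IsTestFunction Ω ψ → ∫ x, u x * fderiv ℝ ψ x e = -∫ x, ψ x * g x

lemma mollify_hasFDerivAt {d : ℕ} (k : ℕ) {u : Euc d → ℝ} (hu : Integrable u volume)
    (x : Euc d) : HasFDerivAt (mollify k u)
      ((u ⋆[(ContinuousLinearMap.lsmul ℝ ℝ).precompR (Euc d), volume]
        fderiv ℝ (mollifier d k)) x) x := by
  have h := (mollifier_hasCompactSupport d k).hasFDerivAt_convolution_right
    (ContinuousLinearMap.lsmul ℝ ℝ) hu.locallyIntegrable
    ((mollifier_contDiff d k).of_le (by norm_cast)) x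
  have e : mollify k u = u ⋆[ContinuousLinearMap.lsmul ℝ ℝ, volume] mollifier d k := by
    funext y
    rw [mollify_apply, convolution_def]
    simp
  rw [e]
  exact h

lemma mollify_contDiff {d : ℕ} (k : ℕ) {u : Euc d → ℝ} (hu : Integrable u volume) :
    ContDiff ℝ 1 (mollify k u) :=
  (mollifier_hasCompactSupport d k).contDiff_convolution_left _
    ((mollifier_contDiff d k).of_le (by norm_cast)) hu.locallyIntegrable

/-- The derivative falls on the smooth kernel, so integrability of u suffices. -/
lemma fderiv_mollify_apply {d : ℕ} (k : ℕ) {u : Euc d → ℝ} (hu : Integrable u volume)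
    (x e : Euc d) :
    fderiv ℝ (mollify k u) x e = ∫ t, u t * fderiv ℝ (mollifier d k) (x - t) e := by
  rw [(mollify_hasFDerivAt k hu x).fderiv, convolution_precompR_apply]
  · rw [convolution_def]; simp
  · exact hu.locallyIntegrable
  · exact (mollifier_hasCompactSupport d k).fderiv ℝ
  · exact (mollifier_contDiff d k).continuous_fderiv (by simp)

lemma isTestFunction_mollifier_comp_sub {d : ℕ} {Ω : Set (Euc d)} (k : ℕ) {x : Euc d}
    (hx : Metric.closedBall x (2 / (k + 1)) ⊆ Ω) :
    IsTestFunction Ω (fun t => mollifier d k (x - t)) := by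
  have hs : tsupport (fun t => mollifier d k (x - t)) ⊆ Metric.closedBall x (2 / (k + 1)) := by
    refine closure_minimal (fun t ht => ?_) Metric.isClosed_closedBall
    have h1 : x - t ∈ Function.support (mollifier d k) := ht
    rw [mollifier, ContDiffBump.support_normed_eq, mem_ball_zero_iff, shrinkingBump_rOut] at h1
    rw [Metric.mem_closedBall, dist_comm, dist_eq_norm]
    exact h1.le
  exact ⟨(mollifier_contDiff d k).comp (contDiff_const.sub contDiff_id),
    (isCompact_closedBall x _).of_isClosed_subset (isClosed_tsupport _) hs, hs.trans hx⟩

/-- Mollification commutes with weak derivatives. -/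
lemma HasWeakDirDeriv.fderiv_mollify {d : ℕ} {Ω : Set (Euc d)} {e : Euc d} {u g : Euc d → ℝ}
    (h : HasWeakDirDeriv Ω e u g) (hu : Integrable u volume) (k : ℕ) {x : Euc d}
    (hx : Metric.closedBall x (2 / (k + 1)) ⊆ Ω) :
    fderiv ℝ (mollify k u) x e = mollify k g x := by
  -- The reflected kernel centred at x is itself an admissible test function. Differentiating it in
  -- t produces a sign that cancels the one from integration by parts.
  have h1 := h _ (isTestFunction_mollifier_comp_sub k hx)
  have h2 : ∀ t, fderiv ℝ (fun t => mollifier d k (x - t)) t e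
      = -fderiv ℝ (mollifier d k) (x - t) e := by
    intro t
    have := ((mollifier_contDiff d k).differentiable (by simp) (x - t)).hasFDerivAt.comp t
      ((hasFDerivAt_const x t).sub (hasFDerivAt_id t))
    rw [show (fun t => mollifier d k (x - t)) = mollifier d k ∘ (fun t => x - t) from rfl,
      HasFDerivAt.fderiv this]
    simp
  simp only [h2, mul_neg, integral_neg, neg_inj] at h1
  rw [fderiv_mollify_apply k hu, h1, mollify_apply]
  simp only [mul_comm]

/-- A compact subset of Ω has a closed thickening inside Ω, so one threshold for k serves all its
points. -/
lemma exists_forall_mollifier_ball_subset {d : ℕ} {Ω K : Set (Euc d)} (hΩ : IsOpen Ω)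
    (hK : IsCompact K) (hKΩ : K ⊆ Ω) :
    ∀ᶠ k : ℕ in atTop, ∀ x ∈ K, Metric.closedBall x (2 / ((k : ℝ) + 1)) ⊆ Ω := by
  obtain ⟨δ, hδ, hsub⟩ := hK.exists_cthickening_subset_open hΩ hKΩ
  filter_upwards [(tendsto_shrinkingBump_rOut d).eventually_le_const hδ] with k hk x hx
  exact (Metric.closedBall_subset_closedBall hk).trans
    ((Metric.closedBall_subset_cthickening hx δ).trans hsub)

/-- Chain rule for bounded `C¹` functions with bounded derivative. -/
lemma HasWeakDirDeriv.comp {d : ℕ} {Ω : Set (Euc d)} (hΩ : IsOpen Ω) {e : Euc d}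
    {u g : Euc d → ℝ} (h : HasWeakDirDeriv Ω e u g) (hu : Integrable u volume)
    (hg : Integrable g volume) {T T' : ℝ → ℝ} (hT : ∀ z, HasDerivAt T (T' z) z)
    (hT' : Continuous T') {M : ℝ} (hM : ∀ z, |T z| ≤ M) (hM' : ∀ z, |T' z| ≤ 1) :
    HasWeakDirDeriv Ω e (fun x => T (u x)) (fun x => T' (u x) * g x) := by
  intro ψ hψ
  have cT : Continuous T := continuous_iff_continuousAt.2 fun z => (hT z).continuousAt
  have cψ := hψ.1.continuous
  have cψ' : Continuous (fun x => fderiv ℝ ψ x e) :=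
    (hψ.1.continuous_fderiv (by simp)).clm_apply continuous_const
  have sψ' : HasCompactSupport (fun x => fderiv ℝ ψ x e) := hψ.2.1.fderiv_apply ℝ e
  have iψ' : Integrable (fun x => fderiv ℝ ψ x e) volume :=
    cψ'.integrable_of_hasCompactSupport sψ'
  obtain ⟨C, hC⟩ := hψ.2.1.exists_bound_of_continuous cψ
  have cu : ∀ k, Continuous (mollify k u) := fun k => (mollify_contDiff k hu).continuous
  have hTu : ∀ k x, HasFDerivAt (fun x => T (mollify k u x))
      (T' (mollify k u x) • fderiv ℝ (mollify k u) x) x := fun k x =>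
    (hT _).comp_hasFDerivAt x
      ((mollify_contDiff k hu).differentiable (by simp) x).hasFDerivAt
  have cd : ∀ k, Continuous (fun x => fderiv ℝ (mollify k u) x e) := fun k =>
    ((mollify_contDiff k hu).continuous_fderiv (by simp)).clm_apply continuous_const
  have bdd : ∀ {a b : Euc d → ℝ} {B : ℝ}, Integrable b volume →
      AEStronglyMeasurable a volume → (∀ x, |a x| ≤ B) →
      Integrable (fun x => a x * b x) volume := fun hb ha hB =>
    hb.bdd_mul ha (Eventually.of_forall hB)
  -- For large k this is classical integration by parts: on the support of ψ the derivative of the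
  -- mollified u is the mollified g, and elsewhere ψ vanishes.
  have parts : ∀ᶠ k in atTop, ∫ x, T (mollify k u x) * fderiv ℝ ψ x e =
      -∫ x, ψ x * (T' (mollify k u x) * mollify k g x) := by
    filter_upwards [exists_forall_mollifier_ball_subset hΩ hψ.2.1 hψ.2.2] with k hk
    have e0 : ∀ x, fderiv ℝ (fun x => T (mollify k u x)) x e =
        T' (mollify k u x) * fderiv ℝ (mollify k u) x e := by
      intro x; rw [(hTu k x).fderiv]; simp
    rw [integral_mul_fderiv_eq_neg_fderiv_mul_of_integrable]
    · congr 1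
      refine integral_congr_ae (Eventually.of_forall fun x => ?_)
      dsimp only
      by_cases hx : x ∈ tsupport ψ
      · rw [e0, h.fderiv_mollify hu k (hk x hx)]; ring
      · rw [image_eq_zero_of_notMem_tsupport hx]; simp
    · simp_rw [e0]
      exact (((hT'.comp (cu k)).mul (cd k)).mul cψ).integrable_of_hasCompactSupport
        hψ.2.1.mul_left
    · exact bdd iψ' (cT.comp (cu k)).aestronglyMeasurable fun x => hM _
    · exact ((cT.comp (cu k)).mul cψ).integrable_of_hasCompactSupport hψ.2.1.mul_left
    · exact fun x _ => (hTu k x).differentiableAt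
    · exact fun x _ => hψ.1.differentiable (by simp) x
  have lim := tendsto_mollify_ae hu
  have left : Tendsto (fun k => ∫ x, T (mollify k u x) * fderiv ℝ ψ x e) atTop
      (𝓝 (∫ x, T (u x) * fderiv ℝ ψ x e)) := by
    refine tendsto_integral_of_dominated_convergence (fun x => M * |fderiv ℝ ψ x e|)
      (fun k => ((cT.comp (cu k)).mul cψ').aestronglyMeasurable) (iψ'.abs.const_mul M)
      (fun k => Eventually.of_forall fun x => ?_) ?_
    · rw [Real.norm_eq_abs, abs_mul]
      exact mul_le_mul_of_nonneg_right (hM _) (abs_nonneg _)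
    · filter_upwards [lim] with x hx
      exact ((cT.tendsto _).comp hx).mul_const _
  have mid : Tendsto (fun k => ∫ x, ψ x * (T' (mollify k u x) * g x)) atTop
      (𝓝 (∫ x, ψ x * (T' (u x) * g x))) := by
    refine tendsto_integral_of_dominated_convergence (fun x => C * |g x|)
      (fun k => cψ.aestronglyMeasurable.mul
        ((hT'.comp (cu k)).aestronglyMeasurable.mul hg.1)) (hg.abs.const_mul C)
      (fun k => Eventually.of_forall fun x => ?_) ?_
    · rw [norm_mul, norm_mul, Real.norm_eq_abs (g x)]
      have := hM' (mollify k u x)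
      refine mul_le_mul (hC x) ?_ (by positivity) ((norm_nonneg _).trans (hC x))
      exact mul_le_of_le_one_left (abs_nonneg _) this
    · filter_upwards [lim] with x hx
      exact (((hT'.tendsto _).comp hx).mul_const _).const_mul _
  -- The mollified g has no evident common dominating function. It is therefore exchanged for g at
  -- an L¹ cost, using |T'| ≤ 1 and the bound on ψ; `mid` then handles the remaining integral with
  -- the fixed dominating function C |g|.
  have err : Tendsto (fun k => (∫ x, ψ x * (T' (mollify k u x) * mollify k g x)) -
      ∫ x, ψ x * (T' (mollify k u x) * g x)) atTop (𝓝 0) := by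
    have h0 := (tendsto_integral_abs_mollify_sub hg).const_mul C
    rw [mul_zero] at h0
    refine squeeze_zero_norm (fun k => ?_) h0
    have ib : ∀ {b : Euc d → ℝ}, Integrable b volume →
        Integrable (fun x => ψ x * (T' (mollify k u x) * b x)) volume := fun hb =>
      bdd (bdd hb (hT'.comp (cu k)).aestronglyMeasurable fun x => hM' _)
        cψ.aestronglyMeasurable hC
    rw [← integral_sub (ib (mollify_integrable k hg)) (ib hg), ← integral_const_mul]
    refine norm_integral_le_of_norm_le (((mollify_integrable k hg).sub hg).abs.const_mul C)
      (Eventually.of_forall fun x => ?_)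
    rw [← mul_sub, ← mul_sub, norm_mul, norm_mul]
    refine mul_le_mul (hC x) ?_ (by positivity) ((norm_nonneg _).trans (hC x))
    exact mul_le_of_le_one_left (abs_nonneg _) (hM' _)
  have right := err.add mid
  simp only [sub_add_cancel, zero_add] at right
  exact tendsto_nhds_unique (left.congr' parts) right.neg

/-! ### Truncation -/

/-- Truncation to `[-β, β]`. -/
def truncation (β z : ℝ) : ℝ := (|z + β| - |z - β|) / 2

/-- The symmetric derivative of the truncation. -/
def truncationDeriv (β z : ℝ) : ℝ := ((z + β) / |z + β| - (z - β) / |z - β|) / 2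

/-- A smooth approximation of the truncation. -/
def smoothTruncation (β ε z : ℝ) : ℝ := (√((z + β) ^ 2 + ε ^ 2) - √((z - β) ^ 2 + ε ^ 2)) / 2

/-- The derivative of the smooth approximation of the truncation. -/
def smoothTruncationDeriv (β ε z : ℝ) : ℝ :=
  ((z + β) / √((z + β) ^ 2 + ε ^ 2) - (z - β) / √((z - β) ^ 2 + ε ^ 2)) / 2

lemma smoothTruncation_hasDerivAt {β ε : ℝ} (hε : 0 < ε) (z : ℝ) :
    HasDerivAt (smoothTruncation β ε) (smoothTruncationDeriv β ε z) z := by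
  have h : ∀ b : ℝ, HasDerivAt (fun z => √((z + b) ^ 2 + ε ^ 2))
      ((z + b) / √((z + b) ^ 2 + ε ^ 2)) z := by
    intro b
    have h1 : HasDerivAt (fun z => (z + b) ^ 2 + ε ^ 2) (2 * (z + b)) z := by
      simpa using (((hasDerivAt_id z).add_const b).pow 2).add_const (ε ^ 2)
    convert h1.sqrt (by positivity) using 1
    field_simp
  have h2 := ((h β).sub (h (-β))).div_const 2
  simp only [← sub_eq_add_neg] at h2
  exact h2

lemma continuous_smoothTruncationDeriv {β ε : ℝ} (hε : 0 < ε) :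
    Continuous (smoothTruncationDeriv β ε) := by
  have h : ∀ b z : ℝ, √((z + b) ^ 2 + ε ^ 2) ≠ 0 := fun b z => by positivity
  have h' : ∀ b z : ℝ, √((z - b) ^ 2 + ε ^ 2) ≠ 0 := fun b z => by positivity
  unfold smoothTruncationDeriv
  fun_prop (disch := first | exact h _ | exact h' _ | exact fun z => h _ z | exact fun z => h' _ z)

lemma abs_div_sqrt_add_sq_le_one (a ε : ℝ) : |a / √(a ^ 2 + ε ^ 2)| ≤ 1 := by
  rw [abs_div, abs_of_nonneg (Real.sqrt_nonneg _)]
  exact div_le_one_of_le₀ (Real.abs_le_sqrt (by nlinarith [sq_nonneg ε])) (Real.sqrt_nonneg _)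

lemma abs_smoothTruncationDeriv_le (β ε z : ℝ) : |smoothTruncationDeriv β ε z| ≤ 1 := by
  have h1 := abs_le.1 (abs_div_sqrt_add_sq_le_one (z + β) ε)
  have h2 := abs_le.1 (abs_div_sqrt_add_sq_le_one (z - β) ε)
  rw [smoothTruncationDeriv, abs_le]
  constructor <;> linarith [h1.1, h1.2, h2.1, h2.2]

/-- The map a ↦ √(a² + ε²) is 1-Lipschitz, and its two arguments z + β and z - β differ by 2β. -/
lemma abs_smoothTruncation_le {β ε : ℝ} (hβ : 0 ≤ β) (hε : 0 < ε) (z : ℝ) :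
    |smoothTruncation β ε z| ≤ β := by
  have key : ∀ a b : ℝ, √(a ^ 2 + ε ^ 2) - √(b ^ 2 + ε ^ 2) ≤ |a - b| := by
    intro a b
    rw [sub_le_iff_le_add, Real.sqrt_le_left (by positivity)]
    have hb : |b| ≤ √(b ^ 2 + ε ^ 2) := Real.abs_le_sqrt (by nlinarith [sq_nonneg ε])
    have hs := Real.sq_sqrt (show 0 ≤ b ^ 2 + ε ^ 2 by positivity)
    have h1 : (a - b) * b ≤ |a - b| * √(b ^ 2 + ε ^ 2) := by
      refine (le_abs_self _).trans ?_
      rw [abs_mul]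
      exact mul_le_mul_of_nonneg_left hb (abs_nonneg _)
    nlinarith [sq_abs (a - b)]
  have h1 := key (z + β) (z - β)
  have h2 := key (z - β) (z + β)
  rw [show z + β - (z - β) = 2 * β by ring, abs_of_nonneg (by linarith)] at h1
  rw [show z - β - (z + β) = -(2 * β) by ring, abs_neg, abs_of_nonneg (by linarith)] at h2
  rw [smoothTruncation, abs_le]
  constructor <;> linarith

lemma tendsto_sqrt_sq_add {ι : Type*} {l : Filter ι} {ε : ι → ℝ} (hε : Tendsto ε l (𝓝 0))
    (a : ℝ) : Tendsto (fun i => √(a ^ 2 + ε i ^ 2)) l (𝓝 |a|) := by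
  have : Tendsto (fun i => √(a ^ 2 + ε i ^ 2)) l (𝓝 √(a ^ 2 + 0 ^ 2)) :=
    (Real.continuous_sqrt.tendsto _).comp ((hε.pow 2).const_add _)
  simpa [Real.sqrt_sq_eq_abs] using this

/-- At a = 0 both sides vanish, by the convention 0 / 0 = 0. This is why `truncationDeriv` is the
limit at the kinks as well. -/
lemma tendsto_div_sqrt_sq_add {ι : Type*} {l : Filter ι} {ε : ι → ℝ} (hε : Tendsto ε l (𝓝 0))
    (a : ℝ) : Tendsto (fun i => a / √(a ^ 2 + ε i ^ 2)) l (𝓝 (a / |a|)) := by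
  by_cases ha : a = 0
  · simpa [ha] using tendsto_const_nhds
  · exact tendsto_const_nhds.div (tendsto_sqrt_sq_add hε a) (abs_ne_zero.2 ha)

lemma tendsto_smoothTruncation {ι : Type*} {l : Filter ι} {ε : ι → ℝ} (hε : Tendsto ε l (𝓝 0))
    (β z : ℝ) : Tendsto (fun i => smoothTruncation β (ε i) z) l (𝓝 (truncation β z)) :=
  ((tendsto_sqrt_sq_add hε _).sub (tendsto_sqrt_sq_add hε _)).div_const 2

lemma tendsto_smoothTruncationDeriv {ι : Type*} {l : Filter ι} {ε : ι → ℝ}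
    (hε : Tendsto ε l (𝓝 0)) (β z : ℝ) :
    Tendsto (fun i => smoothTruncationDeriv β (ε i) z) l (𝓝 (truncationDeriv β z)) :=
  ((tendsto_div_sqrt_sq_add hε _).sub (tendsto_div_sqrt_sq_add hε _)).div_const 2

lemma abs_truncationDeriv_le (β z : ℝ) : |truncationDeriv β z| ≤ 1 :=
  le_of_tendsto (tendsto_smoothTruncationDeriv tendsto_one_div_add_atTop_nhds_zero_nat β z).abs
    (Eventually.of_forall fun _ => abs_smoothTruncationDeriv_le _ _ _)

lemma measurable_truncationDeriv (β : ℝ) : Measurable (truncationDeriv β) := by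
  unfold truncationDeriv
  fun_prop

lemma truncation_of_le {β z : ℝ} (hβ : 0 ≤ β) (h : β ≤ z) : truncation β z = β := by
  rw [truncation, abs_of_nonneg (by linarith), abs_of_nonneg (by linarith)]; ring

lemma truncation_of_le_neg {β z : ℝ} (hβ : 0 ≤ β) (h : z ≤ -β) : truncation β z = -β := by
  rw [truncation, abs_of_nonpos (by linarith), abs_of_nonpos (by linarith)]; ring

lemma truncation_of_abs_le {β z : ℝ} (h : |z| ≤ β) : truncation β z = z := by
  have := abs_le.1 h
  rw [truncation, abs_of_nonneg (by linarith), abs_of_nonpos (by linarith)]; ring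

/-- Chain rule for the truncation. -/
lemma HasWeakDirDeriv.truncation {d : ℕ} {Ω : Set (Euc d)} (hΩ : IsOpen Ω) {e : Euc d}
    {u g : Euc d → ℝ} (h : HasWeakDirDeriv Ω e u g) (hu : Integrable u volume)
    (hg : Integrable g volume) {β : ℝ} (hβ : 0 ≤ β) :
    HasWeakDirDeriv Ω e (fun x => truncation β (u x)) (fun x => truncationDeriv β (u x) * g x) := by
  intro ψ hψ
  have hε0 : ∀ k : ℕ, (0 : ℝ) < 1 / ((k : ℝ) + 1) := fun k => by positivity
  have hε := tendsto_one_div_add_atTop_nhds_zero_nat (𝕜 := ℝ)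
  have cψ := hψ.1.continuous
  have cψ' : Continuous (fun x => fderiv ℝ ψ x e) :=
    (hψ.1.continuous_fderiv (by simp)).clm_apply continuous_const
  have iψ' : Integrable (fun x => fderiv ℝ ψ x e) volume :=
    cψ'.integrable_of_hasCompactSupport (hψ.2.1.fderiv_apply ℝ e)
  obtain ⟨C, hC⟩ := hψ.2.1.exists_bound_of_continuous cψ
  have cT : ∀ k : ℕ, Continuous (smoothTruncation β (1 / ((k : ℝ) + 1))) := fun k =>
    continuous_iff_continuousAt.2 fun z => (smoothTruncation_hasDerivAt (hε0 k) z).continuousAt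
  have left : Tendsto (fun k : ℕ => ∫ x, smoothTruncation β (1 / ((k : ℝ) + 1)) (u x) *
      fderiv ℝ ψ x e) atTop (𝓝 (∫ x, _root_.truncation β (u x) * fderiv ℝ ψ x e)) := by
    refine tendsto_integral_of_dominated_convergence (fun x => β * |fderiv ℝ ψ x e|)
      (fun k => ((cT k).comp_aestronglyMeasurable hu.1).mul cψ'.aestronglyMeasurable)
      (iψ'.abs.const_mul β) (fun k => Eventually.of_forall fun x => ?_)
      (Eventually.of_forall fun x => (tendsto_smoothTruncation hε β _).mul_const _)
    rw [Real.norm_eq_abs, abs_mul]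
    exact mul_le_mul_of_nonneg_right (abs_smoothTruncation_le hβ (hε0 k) _) (abs_nonneg _)
  have right : Tendsto (fun k : ℕ => ∫ x, ψ x * (smoothTruncationDeriv β (1 / ((k : ℝ) + 1)) (u x) *
      g x)) atTop (𝓝 (∫ x, ψ x * (truncationDeriv β (u x) * g x))) := by
    refine tendsto_integral_of_dominated_convergence (fun x => C * |g x|)
      (fun k => cψ.aestronglyMeasurable.mul
        (((continuous_smoothTruncationDeriv (hε0 k)).comp_aestronglyMeasurable hu.1).mul hg.1))
      (hg.abs.const_mul C) (fun k => Eventually.of_forall fun x => ?_)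
      (Eventually.of_forall fun x =>
        ((tendsto_smoothTruncationDeriv hε β _).mul_const _).const_mul _)
    rw [norm_mul, norm_mul, Real.norm_eq_abs (g x)]
    refine mul_le_mul (hC x) ?_ (by positivity) ((norm_nonneg _).trans (hC x))
    exact mul_le_of_le_one_left (abs_nonneg _) (abs_smoothTruncationDeriv_le _ _ _)
  -- The smooth chain rule identifies the two sequences up to sign, so their limits agree.
  refine tendsto_nhds_unique left (right.neg.congr fun k => ?_)
  exact (h.comp hΩ hu hg (smoothTruncation_hasDerivAt (hε0 k))
    (continuous_smoothTruncationDeriv (hε0 k)) (abs_smoothTruncation_le hβ (hε0 k))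
    (abs_smoothTruncationDeriv_le β _) ψ hψ).symm

/-! ### Weak gradients -/

/-- The integration by parts formula, tested in each direction. -/
lemma integratesByParts_iff_inner {d : ℕ} {Ω : Set (Euc d)} (hΩ : MeasurableSet Ω)
    {u : Euc d → ℝ} {G : Euc d → Euc d} {ψ : Euc d → ℝ} (hψ : IsTestFunction Ω ψ)
    (hu : MemLp u 2 (volume.restrict Ω)) (hG : MemLp G 2 (volume.restrict Ω)) :
    IntegratesByParts Ω u G ψ ↔ ∀ e : Euc d, ∫ x, Ω.indicator u x * fderiv ℝ ψ x e =
      -∫ x, ψ x * Ω.indicator (fun x => inner ℝ e (G x)) x := by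
  have e1 : ∀ e, ∫ x, Ω.indicator u x * fderiv ℝ ψ x e =
      inner ℝ e (∫ x in Ω, u x • gradient ψ x) := by
    intro e
    rw [← integral_inner (integrable_smul_of_memLp_two hu hψ.memLp_gradient),
      ← integral_indicator hΩ]
    refine integral_congr_ae (Eventually.of_forall fun x => ?_)
    by_cases hx : x ∈ Ω <;> simp [hx, inner_smul_right]
  have e2 : ∀ e, ∫ x, ψ x * Ω.indicator (fun x => inner ℝ e (G x)) x =
      inner ℝ e (∫ x in Ω, ψ x • G x) := by
    intro e
    rw [← integral_inner (integrable_smul_of_memLp_two hψ.memLp hG), ← integral_indicator hΩ]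
    refine integral_congr_ae (Eventually.of_forall fun x => ?_)
    by_cases hx : x ∈ Ω <;> simp [hx, inner_smul_right]
  simp only [e1, e2, ← inner_neg_right]
  exact ⟨fun h e => by rw [h], fun h => ext_inner_left ℝ h⟩

/-- Extension by zero makes convolution on the whole space available. A jump across the boundary of
Ω is harmless, since only test functions supported in Ω occur. -/
lemma HasWeakGradient.hasWeakDirDeriv {d : ℕ} {Ω : Set (Euc d)} (hΩ : MeasurableSet Ω)
    {u : Euc d → ℝ} {G : Euc d → Euc d} (h : HasWeakGradient Ω u G) (e : Euc d) :
    HasWeakDirDeriv Ω e (Ω.indicator u) (Ω.indicator fun x => inner ℝ e (G x)) :=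
  fun ψ hψ => (integratesByParts_iff_inner hΩ hψ h.1 h.2).1 (h.3 ψ hψ) e

/-- The truncation of an `H¹` function is an `H¹` function. -/
lemma HasWeakGradient.truncation {d : ℕ} {Ω : Set (Euc d)} (hΩ : IsOpen Ω)
    (hΩb : Bornology.IsBounded Ω) {u : Euc d → ℝ} {G : Euc d → Euc d}
    (h : HasWeakGradient Ω u G) {β : ℝ} (hβ : 0 ≤ β) :
    HasWeakGradient Ω (fun x => truncation β (u x)) (fun x => truncationDeriv β (u x) • G x) := by
  have hm := hΩ.measurableSet
  -- Boundedness of Ω makes square integrable functions integrable, as mollification in L¹ requires.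
  have : IsFiniteMeasure (volume.restrict Ω) := ⟨by simpa using hΩb.measure_lt_top⟩
  have cT : Continuous (_root_.truncation β) := by unfold _root_.truncation; fun_prop
  have hle : ∀ z, |_root_.truncation β z| ≤ β := by
    intro z
    refine le_of_tendsto
      (tendsto_smoothTruncation tendsto_one_div_add_atTop_nhds_zero_nat β z).abs
      (Eventually.of_forall fun k => abs_smoothTruncation_le hβ (by positivity) _)
  have m1 : MemLp (fun x => _root_.truncation β (u x)) 2 (volume.restrict Ω) :=
    MemLp.of_bound (cT.comp_aestronglyMeasurable h.1.1) β (Eventually.of_forall fun x => hle _)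
  have m2 : MemLp (fun x => truncationDeriv β (u x) • G x) 2 (volume.restrict Ω) := by
    refine h.2.of_le (((measurable_truncationDeriv β).comp_aemeasurable
      h.1.1.aemeasurable).aestronglyMeasurable.smul h.2.1) (Eventually.of_forall fun x => ?_)
    rw [norm_smul]
    exact mul_le_of_le_one_left (norm_nonneg _) (abs_truncationDeriv_le _ _)
  have iu : Integrable (Ω.indicator u) volume :=
    (integrable_indicator_iff hm).2 (h.1.integrable (by norm_num))
  refine ⟨m1, m2, fun ψ hψ => (integratesByParts_iff_inner hm hψ m1 m2).2 fun e => ?_⟩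
  have ig : Integrable (Ω.indicator fun x => inner ℝ e (G x)) volume :=
    (integrable_indicator_iff hm).2 ((h.2.integrable (by norm_num)).const_inner e)
  have key := (h.hasWeakDirDeriv hm e).truncation hΩ iu ig hβ ψ hψ
  -- The truncation fixes 0, so it commutes with extension by zero.
  have t0 : _root_.truncation β 0 = 0 := truncation_of_abs_le (by simpa using hβ)
  convert key using 3 with x
  · by_cases hx : x ∈ Ω <;> simp [hx, t0]
  · funext x
    by_cases hx : x ∈ Ω <;> simp [hx, inner_smul_right]

/-- Weak gradients are unique up to null sets. -/
lemma HasWeakGradient.ae_eq {d : ℕ} {Ω : Set (Euc d)} (hΩ : IsOpen Ω) {u v : Euc d → ℝ}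
    {G H : Euc d → Euc d} (huv : u =ᵐ[volume.restrict Ω] v)
    (h : HasWeakGradient Ω u G) (h' : HasWeakGradient Ω v H) :
    G =ᵐ[volume.restrict Ω] H := by
  have hm := hΩ.measurableSet
  have hl : LocallyIntegrableOn (fun x => G x - H x) Ω volume :=
    locallyIntegrableOn_of_locallyIntegrable_restrict
      ((h.2.sub h'.2).locallyIntegrable (by norm_num))
  -- Fundamental lemma of the calculus of variations, applied to G - H.
  have key := hΩ.ae_eq_zero_of_integral_contDiff_smul_eq_zero hl fun ψ h1 h2 h3 => by
    have hψ : IsTestFunction Ω ψ := ⟨h1, h2, h3⟩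
    have p1 : ∫ x in Ω, u x • gradient ψ x = -∫ x in Ω, ψ x • G x := h.3 ψ hψ
    have p2 : ∫ x in Ω, v x • gradient ψ x = -∫ x in Ω, ψ x • H x := h'.3 ψ hψ
    have p3 : ∫ x in Ω, u x • gradient ψ x = ∫ x in Ω, v x • gradient ψ x :=
      integral_congr_ae (huv.mono fun x hx => by simp only [hx])
    rw [← setIntegral_eq_integral_of_forall_compl_eq_zero (s := Ω) fun x hx => by
      rw [image_eq_zero_of_notMem_tsupport fun hx' => hx (h3 hx'), zero_smul]]
    simp only [smul_sub]
    rw [integral_sub (integrable_smul_of_memLp_two hψ.memLp h.2)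
      (integrable_smul_of_memLp_two hψ.memLp h'.2), sub_eq_zero]
    exact neg_injective (p1.symm.trans (p3.trans p2))
  filter_upwards [(ae_restrict_iff' hm).2 key] with x hx
  exact sub_eq_zero.1 hx

lemma HasWeakGradient.congr {d : ℕ} {Ω : Set (Euc d)} {u v : Euc d → ℝ} {G : Euc d → Euc d}
    (h : HasWeakGradient Ω u G) (huv : u =ᵐ[volume.restrict Ω] v) : HasWeakGradient Ω v G := by
  refine ⟨(memLp_congr_ae huv).1 h.1, h.2, fun ψ hψ => ?_⟩
  have h3 : ∫ x in Ω, u x • gradient ψ x = -∫ x in Ω, ψ x • G x := h.3 ψ hψ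
  exact (integral_congr_ae (huv.mono fun x hx => by simp only [hx])).trans h3

lemma hasWeakGradient_weakGradient {d : ℕ} {Ω : Set (Euc d)} {u : Euc d → ℝ} (h : u ∈ H1 Ω) :
    HasWeakGradient Ω u (weakGradient Ω u) := by
  have h' : ∃ G, HasWeakGradient Ω u G := h
  rw [weakGradient, dif_pos h']
  exact h'.choose_spec

/-! ### Energy decay under truncation -/

/-- The positive part grows and the negative part shrinks. Subtraction in `EReal` is monotone in
this sense even at ⊤ - ⊤, so no integrability is needed. -/
lemma extendedIntegral_mono {d : ℕ} {μ : Measure (Euc d)} {g h : Euc d → ℝ} (hgh : g ≤ᵐ[μ] h) :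
    extendedIntegral μ g ≤ extendedIntegral μ h := by
  refine EReal.sub_le_sub ?_ ?_
  · exact EReal.coe_ennreal_le_coe_ennreal_iff.2
      (lintegral_mono_ae (hgh.mono fun x hx => ENNReal.ofReal_le_ofReal hx))
  · exact EReal.coe_ennreal_le_coe_ennreal_iff.2
      (lintegral_mono_ae (hgh.mono fun x hx => ENNReal.ofReal_le_ofReal (neg_le_neg hx)))

lemma potential_truncation_le {F f : ℝ → ℝ} (hF : ∀ z, HasDerivAt F (f z) z) {β : ℝ}
    (hβ : 0 ≤ β) (hf_neg : ∀ z, z ≤ -β → f z ≤ 0) (hf_pos : ∀ z, β ≤ z → 0 ≤ f z) (z : ℝ) :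
    F (truncation β z) ≤ F z := by
  have cF : Continuous F := continuous_iff_continuousAt.2 fun z => (hF z).continuousAt
  rcases le_total β z with h1 | h1
  · rw [truncation_of_le hβ h1]
    refine monotoneOn_of_deriv_nonneg (convex_Ici β) cF.continuousOn
      (fun x _ => (hF x).differentiableAt.differentiableWithinAt) (fun x hx => ?_)
      Set.self_mem_Ici h1 h1
    rw [interior_Ici] at hx
    rw [(hF x).deriv]
    exact hf_pos x (le_of_lt hx)
  rcases le_total z (-β) with h2 | h2
  · rw [truncation_of_le_neg hβ h2]
    refine antitoneOn_of_deriv_nonpos (convex_Iic (-β)) cF.continuousOn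
      (fun x _ => (hF x).differentiableAt.differentiableWithinAt) (fun x hx => ?_)
      h2 Set.self_mem_Iic h2
    rw [interior_Iic] at hx
    rw [(hF x).deriv]
    exact hf_neg x (le_of_lt hx)
  · rw [truncation_of_abs_le (abs_le.2 ⟨h2, h1⟩)]

/-- Truncation does not increase the free energy. -/
lemma freeEnergy_le_of_ae_eq_truncation {d : ℕ} {Ω : Set (Euc d)} (hΩ : IsOpen Ω)
    (hΩb : Bornology.IsBounded Ω) {F f : ℝ → ℝ} (hF : ∀ z, HasDerivAt F (f z) z) {β : ℝ}
    (hβ : 0 ≤ β) (hf_neg : ∀ z, z ≤ -β → f z ≤ 0) (hf_pos : ∀ z, β ≤ z → 0 ≤ f z)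
    {u v : Euc d → ℝ} (hv : v =ᵐ[volume.restrict Ω] fun x => truncation β (u x)) :
    freeEnergy Ω F v ≤ freeEnergy Ω F u := by
  by_cases hu : u ∈ H1 Ω
  · have hG := hasWeakGradient_weakGradient hu
    have hT := (hG.truncation hΩ hΩb hβ).congr hv.symm
    have hv1 : v ∈ H1 Ω := ⟨_, hT⟩
    rw [freeEnergy, freeEnergy, if_pos hu, if_pos hv1]
    refine extendedIntegral_mono ?_
    -- The energy of v involves a chosen weak gradient; uniqueness identifies it almost everywhere
    -- with the one from the chain rule.
    filter_upwards [hv, (hasWeakGradient_weakGradient hv1).ae_eq hΩ EventuallyEq.rfl hT]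
      with x hx hx'
    rw [hx, hx', norm_smul]
    have h1 : ‖truncationDeriv β (u x)‖ * ‖weakGradient Ω u x‖ ≤ ‖weakGradient Ω u x‖ :=
      mul_le_of_le_one_left (norm_nonneg _) (abs_truncationDeriv_le _ _)
    gcongr
    exact potential_truncation_le hF hβ hf_neg hf_pos _
  · rw [freeEnergy, freeEnergy, if_neg hu]
    exact le_top

/-! ### The bound correction -/

lemma deriv_boundConstraint (β z : ℝ) : deriv (boundConstraint β) z = -2 * z := by
  have h : HasDerivAt (boundConstraint β) (-1 * (z - β) + -(z + β) * 1) z :=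
    (((hasDerivAt_id z).add_const β).neg).mul ((hasDerivAt_id z).sub_const β)
  rw [h.deriv]; ring

lemma abs_le_of_boundConstraint_nonneg {β z : ℝ} (hβ : 0 ≤ β) (h : 0 ≤ boundConstraint β z) :
    |z| ≤ β :=
  abs_le_of_sq_le_sq (by rw [boundConstraint] at h; linarith) hβ

/-- The maximum bound projection is the truncation. -/
lemma IsBoundCorrection.ae_eq_truncation {d : ℕ} {Ω : Set (Euc d)} {β : ℝ} (hβ : 0 < β)
    {u v l : Euc d → ℝ} (h : IsBoundCorrection Ω β u v l) :
    v =ᵐ[volume.restrict Ω] fun x => truncation β (u x) := by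
  filter_upwards [h] with x ⟨h1, h2, h3, h4⟩
  rw [deriv_boundConstraint] at h1
  -- Either λ = 0 and the value is unchanged and already within the bounds, or the new value is ±β.
  -- In the latter case p'(z) = -2z gives the old value as ±(β + 2λβ), which lies at or beyond the
  -- same bound.
  rcases mul_eq_zero.1 h4 with hl | hp
  · have e : v x = u x := by rw [hl] at h1; linarith
    rw [e] at h3 ⊢
    exact (truncation_of_abs_le (abs_le_of_boundConstraint_nonneg hβ.le h3)).symm
  · rw [boundConstraint] at hp
    rcases mul_eq_zero.1 hp with hv | hv
    · have e : v x = -β := by linarith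
      rw [e] at h1 ⊢
      exact (truncation_of_le_neg hβ.le (by nlinarith [mul_nonneg h2 hβ.le])).symm
    · have e : v x = β := by linarith
      rw [e] at h1 ⊢
      exact (truncation_of_le hβ.le (by nlinarith [mul_nonneg h2 hβ.le])).symm

lemma IsBoundCorrection.eLpNorm_le {d : ℕ} {Ω : Set (Euc d)} {β : ℝ} (hβ : 0 ≤ β)
    {u v l : Euc d → ℝ} (h : IsBoundCorrection Ω β u v l) :
    eLpNorm v ∞ (volume.restrict Ω) ≤ ENNReal.ofReal β := by
  rw [eLpNorm_exponent_top]
  refine eLpNormEssSup_le_of_ae_bound ?_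
  filter_upwards [h] with x hx
  exact abs_le_of_boundConstraint_nonneg hβ hx.2.2.1

end

theorem mainTheorem2 {d : ℕ} (Ω : Set (Euc d)) (hΩ : IsOpen Ω) (hΩb : Bornology.IsBounded Ω)
    (V : Submodule ℝ (Euc d → ℝ)) (hV : IsBoundarySpace Ω V)
    (F f : ℝ → ℝ) (hF : ∀ z, HasDerivAt F (f z) z) (hf : ContDiff ℝ 1 f)
    (β : ℝ) (hβ : 0 < β) (hf_neg : ∀ z, z ≤ -β → f z ≤ 0) (hf_pos : ∀ z, β ≤ z → 0 ≤ f z)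
    (Φ : ℝ → (Euc d → ℝ) → (Euc d → ℝ)) (τ : ℝ) (hτ : 0 < τ)
    (φ : ℕ → Euc d → ℝ) (h0 : φ 0 ∈ V)
    (h0_bound : eLpNorm (φ 0) ∞ (volume.restrict Ω) ≤ ENNReal.ofReal β)
    (hφ : IsPCCSolution Ω V F f β (Φ τ) φ) :
    ∀ n, eLpNorm (φ n) ∞ (volume.restrict Ω) ≤ ENNReal.ofReal β ∧
      freeEnergy Ω F (φ (n + 1)) ≤ freeEnergy Ω F (φ n) := by
  intro n
  constructor
  -- The bound is assumed for the initial datum; afterwards each iterate is itself the output of a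
  -- bound correction, so no induction hypothesis is used.
  · cases n with
    | zero => exact h0_bound
    | succ n =>
      obtain ⟨-, φs, η, l, -, hb⟩ := hφ n
      exact hb.eLpNorm_le hβ.le
  · obtain ⟨-, φs, η, l, hc, hb⟩ := hφ n
    exact (freeEnergy_le_of_ae_eq_truncation hΩ hΩb hF hβ.le hf_neg hf_pos
      (hb.ae_eq_truncation hβ)).trans hc.energy_le
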